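/- Let $K$ be a field of characteristic $0$. Algebras are (not necessarily associative or unital) $K$-algebras. Let $\mathfrak B$ be the variety of bicommutative algebras, i.e. the class of all algebras satisfying the identities $(x_1x_2)x_3=(x_1x_3)x_2$ and $x_1(x_2x_3)=x_2(x_1x_3)$. For $\pi,\varrho\in K$ let $A_{\pi,\varrho}$ be the two-dimensional algebra with basis $\{r,r^2\}$ and multiplication $r\cdot r=r^2$, $r\cdot r^2=\pi r^2$, $r^2\cdot r=\varrho r^2$, $r^2\cdot r^2=\pi\varrho r^2$. For an algebra $A$ let $\mathrm{var}(A)$ be the variety generated by $A$, i.e. the class of all algebras satisfying every polynomial identity of $A$. For $n\ge 1$ let $F_n(\mathrm{var}(A))$ be the quotient of the free nonassociative algebra on $x_1,\dots,x_n$ by the polynomial identities of $A$ in $x_1,\dots,x_n$, let $P_n(A)\subseteq F_n(\mathrm{var}(A))$ be the subspace of multilinear polynomials of degree $n$ (the span of the images of all nonassociative monomials containing each of $x_1,\dots,x_n$ exactly once), let $c_n(A)=\dim_K P_n(A)$, and let the cocharacter $\chi_n(A)$ be the character of the symmetric group $S_n$ on $P_n(A)$ under the action $\sigma(f(x_1,\dots,x_n))=f(x_{\sigma(1)},\dots,x_{\sigma(n)})$.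 For a partition $\lambda$ of $n$ let $\chi_\lambda$ be the irreducible $S_n$-character indexed by $\lambda$. (i) As subvarieties of $\mathfrak B$, the variety $\mathrm{var}(A_{0,1})$ is defined by the identity $x_1(x_2x_3)=0$ and the variety $\mathrm{var}(A_{1,0})$ is defined by the identity $(x_1x_2)x_3=0$. Moreover $$\chi_1(A_{0,1})=\chi_1(A_{1,0})=\chi_{(1)},\qquad \chi_n(A_{0,1})=\chi_n(A_{1,0})=\chi_{(n)}+\chi_{(n-1,1)}\quad (n\ge 2),$$ $$c_n(A_{0,1})=c_n(A_{1,0})=n\quad (n\ge 1).$$ (ii) The algebra $A_{1,-1}$ generates the whole variety $\mathfrak B$, i.e. $\mathrm{var}(A_{1,-1})=\mathfrak B$. -/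

import Mathlib

/-! ## Polynomial identities of nonassociative algebras

The absolutely free (nonassociative, nonunital) algebra `K{X}` is Mathlib's
`FreeNonUnitalNonAssocAlgebra K X`. -/

noncomputable section

namespace BicommVar

section Identities

variable (K : Type*) [Field K] (X : Type*)
  (A : Type*) [NonUnitalNonAssocRing A] [Module K A] [IsScalarTower K A A] [SMulCommClass K A A]

/-- The polynomial identities of the algebra `A` in the variables `X`: those `f ∈ K{X}` which vanish
under every substitution of elements of `A` for the variables. -/
def identities : Submodule K (FreeNonUnitalNonAssocAlgebra K X) where
  carrier := {f | ∀ v : X → A, FreeNonUnitalNonAssocAlgebra.lift K v f = 0}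
  add_mem' := by
    intro f g hf hg v
    rw [map_add, hf v, hg v, add_zero]
  zero_mem' := by
    intro v
    rw [map_zero]
  smul_mem' := by
    intro c f hf v
    rw [map_smul, hf v, smul_zero]

end Identities

/-- The variety defined by a set `S` of polynomials in countably many variables: the class of all
`K`-algebras `B` that satisfy `f = 0` for every `f ∈ S`. -/
def InVariety {K : Type*} [Field K] (S : Set (FreeNonUnitalNonAssocAlgebra K ℕ))
    (B : Type*) [NonUnitalNonAssocRing B] [Module K B] [IsScalarTower K B B]
    [SMulCommClass K B B] : Prop :=
  ∀ f ∈ S, f ∈ identities K ℕ B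

/-- The variety `var(A)` generated by the algebra `A`: the class of all `K`-algebras `B` that satisfy
all polynomial identities of `A`. -/
def InVarietyGeneratedBy (K : Type*) [Field K]
    (A : Type*) [NonUnitalNonAssocRing A] [Module K A] [IsScalarTower K A A] [SMulCommClass K A A]
    (B : Type*) [NonUnitalNonAssocRing B] [Module K B] [IsScalarTower K B B]
    [SMulCommClass K B B] : Prop :=
  InVariety (identities K ℕ A : Set (FreeNonUnitalNonAssocAlgebra K ℕ)) B

section Polynomials

variable (K : Type*) [Field K]

/-- The variable `x_i` of the free algebra of countable rank. -/
def x (i : ℕ) : FreeNonUnitalNonAssocAlgebra K ℕ :=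
  FreeNonUnitalNonAssocAlgebra.of K i

/-- The polynomials `(x₁x₂)x₃ - (x₁x₃)x₂` and `x₁(x₂x₃) - x₂(x₁x₃)` of right- and
left-commutativity, which define the variety `𝔅` of bicommutative algebras. -/
def bicommutativity : Set (FreeNonUnitalNonAssocAlgebra K ℕ) :=
  {(x K 1 * x K 2) * x K 3 - (x K 1 * x K 3) * x K 2,
    x K 1 * (x K 2 * x K 3) - x K 2 * (x K 1 * x K 3)}

/-- The polynomial `x₁(x₂x₃)`. -/
def leftNilpotency : FreeNonUnitalNonAssocAlgebra K ℕ :=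
  x K 1 * (x K 2 * x K 3)

/-- The polynomial `(x₁x₂)x₃`. -/
def rightNilpotency : FreeNonUnitalNonAssocAlgebra K ℕ :=
  (x K 1 * x K 2) * x K 3

end Polynomials

/-! ## Multilinear polynomials, codimensions and cocharacters -/

/-- The multiset of the letters of a nonassociative word, each counted with multiplicity. -/
def letters {X : Type*} : FreeMagma X → Multiset X
  | FreeMagma.of a => {a}
  | FreeMagma.mul u w => letters u + letters w

/-- The multilinear polynomials of degree `n` in `K{x_1, …, x_n}`: the linear combinations of the
nonassociative words in which each of the `n` variables occurs exactly once. -/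
def multilinear (K : Type*) [Field K] (n : ℕ) :
    Submodule K (FreeNonUnitalNonAssocAlgebra K (Fin n)) :=
  Submodule.span K
    {f | ∃ w : FreeMagma (Fin n), letters w = Finset.univ.val ∧ f = MonoidAlgebra.ofMagma K _ w}

/-- The substitution `f(x_1, …, x_n) ↦ f(x_{σ(1)}, …, x_{σ(n)})`, as an action of the symmetric
group on `K{x_1, …, x_n}`. -/
def permuteVars (K : Type*) [Field K] (n : ℕ) :
    Representation K (Equiv.Perm (Fin n)) (FreeNonUnitalNonAssocAlgebra K (Fin n)) where
  toFun σ :=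
    { toFun := fun f =>
        FreeNonUnitalNonAssocAlgebra.lift K
          (fun i => FreeNonUnitalNonAssocAlgebra.of K (σ i)) f
      map_add' := fun f g => map_add _ f g
      map_smul' := fun c f => map_smul _ c f }
  map_one' := by
    apply LinearMap.ext
    intro f
    have h : FreeNonUnitalNonAssocAlgebra.lift K
        (fun i => FreeNonUnitalNonAssocAlgebra.of K ((1 : Equiv.Perm (Fin n)) i)) =
        NonUnitalAlgHom.id K (FreeNonUnitalNonAssocAlgebra K (Fin n)) := by
      apply FreeNonUnitalNonAssocAlgebra.hom_ext
      intro i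
      simp
    exact DFunLike.congr_fun h f
  map_mul' σ τ := by
    apply LinearMap.ext
    intro f
    have h : FreeNonUnitalNonAssocAlgebra.lift K
        (fun i => FreeNonUnitalNonAssocAlgebra.of K ((σ * τ) i)) =
        (FreeNonUnitalNonAssocAlgebra.lift K
          (fun i => FreeNonUnitalNonAssocAlgebra.of K (σ i))).comp
        (FreeNonUnitalNonAssocAlgebra.lift K
          (fun i => FreeNonUnitalNonAssocAlgebra.of K (τ i))) := by
      apply FreeNonUnitalNonAssocAlgebra.hom_ext
      intro i
      simp
    exact DFunLike.congr_fun h f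

theorem permuteVars_apply (K : Type*) [Field K] (n : ℕ) (σ : Equiv.Perm (Fin n))
    (f : FreeNonUnitalNonAssocAlgebra K (Fin n)) :
    permuteVars K n σ f = FreeNonUnitalNonAssocAlgebra.lift K
      (fun i => FreeNonUnitalNonAssocAlgebra.of K (σ i)) f := rfl

theorem letters_map {X Y : Type*} (g : X → Y) (w : FreeMagma X) :
    letters (FreeMagma.map g w) = (letters w).map g := by
  induction w with
  | ih1 a => rfl
  | ih2 u w hu hw =>
    have h1 : ∀ a b : FreeMagma Y, letters (a * b) = letters a + letters b := fun _ _ => rfl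
    have h2 : ∀ a b : FreeMagma X, letters (a * b) = letters a + letters b := fun _ _ => rfl
    rw [map_mul, h1, h2, hu, hw, Multiset.map_add]

theorem permuteVars_word (K : Type*) [Field K] (n : ℕ) (σ : Equiv.Perm (Fin n))
    (w : FreeMagma (Fin n)) :
    permuteVars K n σ (MonoidAlgebra.ofMagma K _ w) =
      MonoidAlgebra.ofMagma K _ (FreeMagma.map σ w) := by
  rw [permuteVars_apply]
  induction w with
  | ih1 a =>
    exact FreeNonUnitalNonAssocAlgebra.lift_of_apply K
      (fun i => FreeNonUnitalNonAssocAlgebra.of K (σ i)) a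
  | ih2 u w hu hw => rw [map_mul, map_mul, hu, hw, map_mul, map_mul]

theorem permuteVars_mem_multilinear (K : Type*) [Field K] (n : ℕ) (σ : Equiv.Perm (Fin n)) :
    multilinear K n ≤ (multilinear K n).comap (permuteVars K n σ) := by
  refine Submodule.span_le.2 ?_
  rintro f ⟨w, hw, rfl⟩
  refine Submodule.subset_span ⟨FreeMagma.map σ w, ?_, permuteVars_word K n σ w⟩
  rw [letters_map, hw]
  have h := congrArg Finset.val (Finset.map_univ_equiv σ)
  rwa [Finset.map_val] at h

section Codimensions

variable (K : Type*) [Field K]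
  (A : Type*) [NonUnitalNonAssocRing A] [Module K A] [IsScalarTower K A A] [SMulCommClass K A A]
  (n : ℕ)

theorem permuteVars_mem_identities (σ : Equiv.Perm (Fin n)) :
    identities K (Fin n) A ≤ (identities K (Fin n) A).comap (permuteVars K n σ) := by
  intro f hf v
  have h : (FreeNonUnitalNonAssocAlgebra.lift K v).comp
      (FreeNonUnitalNonAssocAlgebra.lift K
        (fun i => FreeNonUnitalNonAssocAlgebra.of K (σ i))) =
      FreeNonUnitalNonAssocAlgebra.lift K (fun i => v (σ i)) := by
    apply FreeNonUnitalNonAssocAlgebra.hom_ext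
    intro i
    simp
  have h2 := DFunLike.congr_fun h f
  exact h2.trans (hf _)

/-- The underlying vector space of the relatively free algebra `F_n(var(A))` of rank `n`, i.e. of
`K{x_1, …, x_n}` modulo the polynomial identities of `A`. -/
abbrev RelFree : Type _ :=
  FreeNonUnitalNonAssocAlgebra K (Fin n) ⧸ identities K (Fin n) A

/-- The space `P_n(var(A))` of the multilinear polynomials of degree `n` in `F_n(var(A))`. -/
def relMultilinear : Submodule K (RelFree K A n) :=
  (multilinear K n).map (identities K (Fin n) A).mkQ

/-- The codimension `c_n(A) = dim P_n(var(A))`. -/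
def codimension : ℕ :=
  Module.finrank K (relMultilinear K A n)

/-- The action of the symmetric group on `F_n(var(A))` by permutation of the variables. -/
def relPermuteVars : Representation K (Equiv.Perm (Fin n)) (RelFree K A n) where
  toFun σ := Submodule.mapQ _ _ (permuteVars K n σ) (permuteVars_mem_identities K A n σ)
  map_one' := by
    ext f
    simp
  map_mul' σ τ := by
    ext f
    simp

theorem relPermuteVars_mem (σ : Equiv.Perm (Fin n)) :
    ∀ f ∈ relMultilinear K A n, relPermuteVars K A n σ f ∈ relMultilinear K A n := by
  rintro _ ⟨f, hf, rfl⟩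
  exact ⟨permuteVars K n σ f, permuteVars_mem_multilinear K n σ hf, rfl⟩

/-- The action of the symmetric group on `P_n(var(A))` by permutation of the variables. -/
def multilinearRep : Representation K (Equiv.Perm (Fin n)) (relMultilinear K A n) where
  toFun σ := (relPermuteVars K A n σ).restrict (relPermuteVars_mem K A n σ)
  map_one' := by
    ext f
    simp
  map_mul' σ τ := by
    ext f
    simp

/-- The cocharacter `χ_n(A)`: the character of the symmetric group on `P_n(var(A))`. -/
def cocharacter : Equiv.Perm (Fin n) → K :=
  (multilinearRep K A n).character

end Codimensions

/-! ## Irreducible characters of the symmetric group -/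

section Specht

variable (K : Type*) [Field K] (n : ℕ)

/-- The Specht polynomial of a tableau `T` of shape `μ` with entries `1, …, n` (each used once): the
product, over all pairs of cells of the same column, of the differences of the variables that
correspond to the upper and the lower cell. -/
def spechtPolynomial (μ : YoungDiagram) (T : μ.cells ≃ Fin n) : MvPolynomial (Fin n) K :=
  ∏ p : μ.cells × μ.cells with p.1.1.2 = p.2.1.2 ∧ p.1.1.1 < p.2.1.1,
    (MvPolynomial.X (T p.1) - MvPolynomial.X (T p.2))

/-- The Specht module of shape `μ`: the span of the Specht polynomials of all tableaux of
shape `μ`. For `K` of characteristic `0` and `μ` with `n` cells it is the irreducible module of the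
symmetric group that corresponds to `μ`. -/
def spechtModule (μ : YoungDiagram) : Submodule K (MvPolynomial (Fin n) K) :=
  Submodule.span K (Set.range (spechtPolynomial K n μ))

theorem rename_mem_spechtModule (μ : YoungDiagram) (σ : Equiv.Perm (Fin n)) :
    ∀ f ∈ spechtModule K n μ,
      (MvPolynomial.rename (R := K) σ).toLinearMap f ∈ spechtModule K n μ := by
  intro f hf
  have h : spechtModule K n μ ≤
      (spechtModule K n μ).comap (MvPolynomial.rename (R := K) σ).toLinearMap := by
    refine Submodule.span_le.2 ?_
    rintro _ ⟨T, rfl⟩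
    refine Submodule.subset_span ⟨T.trans σ, ?_⟩
    simp [spechtPolynomial, map_prod]
  exact h hf

/-- The symmetric group acting on the Specht module by permutation of the variables. -/
def spechtRep (μ : YoungDiagram) :
    Representation K (Equiv.Perm (Fin n)) (spechtModule K n μ) where
  toFun σ := (MvPolynomial.rename (R := K) σ).toLinearMap.restrict
    (rename_mem_spechtModule K n μ σ)
  map_one' := by
    apply LinearMap.ext
    intro f
    apply Subtype.ext
    simp
  map_mul' σ τ := by
    apply LinearMap.ext
    intro f
    apply Subtype.ext
    simp [MvPolynomial.rename_rename]

/-- The irreducible character `χ_μ` of the symmetric group of degree `n`, for a Young diagram `μ`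
with `n` cells. -/
def irrChar (μ : YoungDiagram) : Equiv.Perm (Fin n) → K :=
  (spechtRep K n μ).character

end Specht

/-- The Young diagram of the partition `(a)`. -/
def oneRow (a : ℕ) : YoungDiagram :=
  YoungDiagram.ofRowLens [a] (by simp [List.sortedGE_iff_pairwise])

/-- The Young diagram of the partition `(a, b)`, `a ≥ b`. -/
def twoRows (a b : ℕ) (h : b ≤ a) : YoungDiagram :=
  YoungDiagram.ofRowLens [a, b] (by simp [List.sortedGE_iff_pairwise, h])

/-! ## The two-dimensional algebras -/

/-- The two-dimensional algebra `A_{π,ϱ}`: the element with coordinates `a`, `b` is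
`a r + b r²`. -/
@[ext]
structure TwoDim {K : Type*} (π ϱ : K) where
  /-- the coefficient of `r` -/
  a : K
  /-- the coefficient of `r²` -/
  b : K

namespace TwoDim

variable {K : Type*} [Field K] (π ϱ : K)

instance : Zero (TwoDim π ϱ) := ⟨⟨0, 0⟩⟩
instance : Add (TwoDim π ϱ) := ⟨fun u v => ⟨u.a + v.a, u.b + v.b⟩⟩
instance : Neg (TwoDim π ϱ) := ⟨fun u => ⟨-u.a, -u.b⟩⟩
instance : SMul K (TwoDim π ϱ) := ⟨fun c u => ⟨c * u.a, c * u.b⟩⟩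

/-- The bilinear multiplication with `r·r = r²`, `r·r² = π r²`, `r²·r = ϱ r²`, `r²·r² = πϱ r²`. -/
instance : Mul (TwoDim π ϱ) :=
  ⟨fun u v => ⟨0, u.a * v.a + π * (u.a * v.b) + ϱ * (u.b * v.a) + π * ϱ * (u.b * v.b)⟩⟩

variable {π ϱ}

@[simp] theorem zero_a : (0 : TwoDim π ϱ).a = 0 := rfl
@[simp] theorem zero_b : (0 : TwoDim π ϱ).b = 0 := rfl
@[simp] theorem add_a (u v : TwoDim π ϱ) : (u + v).a = u.a + v.a := rfl
@[simp] theorem add_b (u v : TwoDim π ϱ) : (u + v).b = u.b + v.b := rfl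
@[simp] theorem neg_a (u : TwoDim π ϱ) : (-u).a = -u.a := rfl
@[simp] theorem neg_b (u : TwoDim π ϱ) : (-u).b = -u.b := rfl
@[simp] theorem smul_a (c : K) (u : TwoDim π ϱ) : (c • u).a = c * u.a := rfl
@[simp] theorem smul_b (c : K) (u : TwoDim π ϱ) : (c • u).b = c * u.b := rfl
@[simp] theorem mul_a (u v : TwoDim π ϱ) : (u * v).a = 0 := rfl
@[simp] theorem mul_b (u v : TwoDim π ϱ) : (u * v).b =
    u.a * v.a + π * (u.a * v.b) + ϱ * (u.b * v.a) + π * ϱ * (u.b * v.b) := rfl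

variable (π ϱ)

instance : NonUnitalNonAssocRing (TwoDim π ϱ) where
  add_assoc u v w := by ext <;> simp [add_assoc]
  zero_add u := by ext <;> simp
  add_zero u := by ext <;> simp
  add_comm u v := by ext <;> simp [add_comm]
  neg_add_cancel u := by ext <;> simp
  nsmul := nsmulRec
  zsmul := zsmulRec
  left_distrib u v w := by ext <;> simp <;> ring
  right_distrib u v w := by ext <;> simp <;> ring
  zero_mul u := by ext <;> simp
  mul_zero u := by ext <;> simp

instance : Module K (TwoDim π ϱ) where
  one_smul u := by ext <;> simp
  mul_smul c d u := by ext <;> simp [mul_assoc]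
  smul_zero c := by ext <;> simp
  smul_add c u v := by ext <;> simp [mul_add]
  add_smul c d u := by ext <;> simp [add_mul]
  zero_smul u := by ext <;> simp

instance : IsScalarTower K (TwoDim π ϱ) (TwoDim π ϱ) where
  smul_assoc c u v := by
    ext
    · simp
    · simp only [smul_eq_mul, mul_b, smul_a, smul_b]
      ring

instance : SMulCommClass K (TwoDim π ϱ) (TwoDim π ϱ) where
  smul_comm c u v := by
    ext
    · simp
    · simp only [smul_eq_mul, mul_b, smul_a, smul_b]
      ring

/-- The generator `r` of `A_{π,ϱ}`. -/
def r : TwoDim π ϱ := ⟨1, 0⟩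

theorem r_mul_sq : r π ϱ * (r π ϱ * r π ϱ) = π • (r π ϱ * r π ϱ) := by
  ext <;> simp [r]

theorem sq_mul_r : (r π ϱ * r π ϱ) * r π ϱ = ϱ • (r π ϱ * r π ϱ) := by
  ext <;> simp [r]

theorem sq_mul_sq : (r π ϱ * r π ϱ) * (r π ϱ * r π ϱ) = (π * ϱ) • (r π ϱ * r π ϱ) := by
  ext <;> simp [r]

theorem eq_smul_add_smul (u : TwoDim π ϱ) : u = u.a • r π ϱ + u.b • (r π ϱ * r π ϱ) := by
  ext <;> simp [r]

end TwoDim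

end BicommVar

end

/-! Tag each leaf of a word as the left or the right factor of the product in which it stands. In a
bicommutative algebra, all left and right multiplications commute with one another when they act on
products (`IsBicommutative.mul_mul_comm`). So a word of degree at least two equals some `x_i x_j`
acted on by its remaining leaves, each from the side given by its tag, and its value depends only on
the multiset of tagged leaves (`IsBicommutative.lift_mul_congr`).

In `A_{π,ϱ}` the product has rank one: `uv = ℓ(u) ρ(v) r²` with linear forms `ℓ`, `ρ`, and `ℓ(r²) =
ϱ`, `ρ(r²) = π`. A word with `p` left and `q` right leaves therefore takes the value `π^(p-1)
ϱ^(q-1)` times the product of the forms at its tagged leaves, times `r²` (`TwoDim.lift_mul_b`). For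
`π ≠ ϱ` the two forms are independent, so over an infinite field distinct tag multisets give
distinct monomials in independent variables. Hence the identities of `A_{π,ϱ}` follow from
bicommutativity and the vanishing of the words of weight zero (`TwoDim.identities_le`). For `(0,1)`
these are the words with more than one left leaf, which `x₁(x₂x₃) = 0` kills; `(1,0)` is the mirror
image; for `(1,-1)` every weight is `±1`, so nothing is added to bicommutativity.

For `(0,1)` and `n ≥ 2` a surviving multilinear word is determined by its unique left leaf, so `P_n`
is the natural permutation module `Kⁿ`. Its character counts fixed points. In characteristic zero
`Kⁿ` splits into the constants and the vectors of coordinate sum zero, and the latter form the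
Specht module of shape `(n-1,1)` (`irrChar_twoRows`). -/

noncomputable section

namespace BicommVar

/-! ## Left and right leaves of nonassociative words -/

section Words

variable {X : Type*}

/-- The multiset of the leaves of a word, tagged with `inl` for a left factor and with `inr` for a
right factor. A word which is a single letter counts as a left factor if and only if the Boolean
argument is `true`. -/
def sides : Bool → FreeMagma X → Multiset (X ⊕ X)
  | true, FreeMagma.of a => {Sum.inl a}
  | false, FreeMagma.of a => {Sum.inr a}
  | _, FreeMagma.mul u w => sides true u + sides false w

@[simp] theorem sides_true_of (a : X) : sides true (FreeMagma.of a) = {Sum.inl a} := rfl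

@[simp] theorem sides_false_of (a : X) : sides false (FreeMagma.of a) = {Sum.inr a} := rfl

@[simp] theorem sides_mul (s : Bool) (u w : FreeMagma X) :
    sides s (u * w) = sides true u + sides false w := by
  cases s <;> rfl

theorem letters_mul (u w : FreeMagma X) : letters (u * w) = letters u + letters w := rfl

theorem letters_eq_map_sides (s : Bool) (w : FreeMagma X) :
    letters w = (sides s w).map (Sum.elim id id) := by
  induction w generalizing s with
  | ih1 a => cases s <;> rfl
  | ih2 u w hu hw => rw [sides_mul, Multiset.map_add, ← hu, ← hw, letters_mul]

theorem sides_map {Y : Type*} (g : X → Y) (s : Bool) (w : FreeMagma X) :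
    sides s (FreeMagma.map g w) = (sides s w).map (Sum.map g g) := by
  induction w generalizing s with
  | ih1 a => cases s <;> rfl
  | ih2 u w hu hw => rw [map_mul, sides_mul, sides_mul, Multiset.map_add, hu, hw]

/-- The number of leaves tagged as left factors. -/
def leftCount (m : Multiset (X ⊕ X)) : ℕ := m.countP (fun t => t.isLeft = true)

/-- The number of leaves tagged as right factors. -/
def rightCount (m : Multiset (X ⊕ X)) : ℕ := m.countP (fun t => t.isRight = true)

@[simp] theorem leftCount_add (m k : Multiset (X ⊕ X)) :
    leftCount (m + k) = leftCount m + leftCount k := Multiset.countP_add _ _ _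

@[simp] theorem rightCount_add (m k : Multiset (X ⊕ X)) :
    rightCount (m + k) = rightCount m + rightCount k := Multiset.countP_add _ _ _

@[simp] theorem leftCount_inl (a : X) : leftCount ({Sum.inl a} : Multiset (X ⊕ X)) = 1 := by
  rfl

@[simp] theorem leftCount_inr (a : X) : leftCount ({Sum.inr a} : Multiset (X ⊕ X)) = 0 := by
  rfl

@[simp] theorem rightCount_inl (a : X) : rightCount ({Sum.inl a} : Multiset (X ⊕ X)) = 0 := by
  rfl

@[simp] theorem rightCount_inr (a : X) : rightCount ({Sum.inr a} : Multiset (X ⊕ X)) = 1 := by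
  rfl

/-- The leftmost leaf is always a left leaf. This and its mirror image make the truncated exponents
`leftCount - 1` and `rightCount - 1` genuine on products. -/
theorem leftCount_pos (w : FreeMagma X) : 0 < leftCount (sides true w) := by
  induction w with
  | ih1 a => simp
  | ih2 u w hu _ => simp; omega

theorem rightCount_pos (w : FreeMagma X) : 0 < rightCount (sides false w) := by
  induction w with
  | ih1 a => simp
  | ih2 u w _ hw => simp; omega

/-- Start from `x_i x_j` and multiply by one letter at a time, from the side that its tag
prescribes. -/
theorem exists_mul_sides (i j : X) (t : Multiset (X ⊕ X)) :
    ∃ u w : FreeMagma X, sides true (u * w) = {Sum.inl i} + {Sum.inr j} + t := by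
  induction t using Multiset.induction_on with
  | empty => exact ⟨.of i, .of j, by simp⟩
  | cons a t ih =>
    obtain ⟨u, w, h⟩ := ih
    rw [sides_mul] at h
    rcases a with a | a
    · refine ⟨.of a, u * w, ?_⟩
      rw [sides_mul, sides_mul, h, sides_true_of, ← Multiset.singleton_add]
      abel
    · refine ⟨u * w, .of a, ?_⟩
      rw [sides_mul, sides_mul, h, sides_false_of, ← Multiset.singleton_add]
      abel

end Words

/-! ## Values of words in bicommutative algebras -/

section Bicommutative

variable {X B : Type*} [NonUnitalNonAssocRing B]

/-- The values of the products in `B`. -/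
abbrev Products (B : Type*) [Mul B] := {b : B // ∃ c d, b = c * d}

/-- Multiplication of a product by a tagged element, from the side given by the tag. -/
def sideMul (v : X → B) : X ⊕ X → Products B → Products B
  | Sum.inl i, b => ⟨v i * b.1, _, _, rfl⟩
  | Sum.inr i, b => ⟨b.1 * v i, _, _, rfl⟩

/-- The axioms of bicommutative algebras. -/
structure IsBicommutative (B : Type*) [Mul B] : Prop where
  right_comm : ∀ a b c : B, a * b * c = a * c * b
  left_comm : ∀ a b c : B, a * (b * c) = b * (a * c)

variable (hB : IsBicommutative B)
include hB

/-- Left and right multiplications commute on products. The middle factor has to be a product: its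
factors `c` and `d` are exchanged with `a` and `b`. -/
theorem IsBicommutative.mul_mul_comm (a c d b : B) : a * (c * d * b) = a * (c * d) * b := by
  rw [hB.left_comm a c d, hB.right_comm c (a * d) b, hB.left_comm (c * b) a d, hB.right_comm c b d]

theorem IsBicommutative.leftCommutative (v : X → B) : LeftCommutative (sideMul v) := by
  constructor
  rintro (i | i) (j | j) ⟨_, c, d, rfl⟩ <;> apply Subtype.ext <;> simp only [sideMul]
  · exact hB.left_comm _ _ _
  · exact hB.mul_mul_comm _ _ _ _
  · exact (hB.mul_mul_comm _ _ _ _).symm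
  · exact hB.right_comm _ _ _

/-- Multiplication of a product by the elements of a multiset, from the sides given by the tags. -/
def IsBicommutative.act (v : X → B) (m : Multiset (X ⊕ X)) (b : Products B) : Products B :=
  haveI := hB.leftCommutative v
  m.foldr (sideMul v) b

theorem IsBicommutative.act_add (v : X → B) (m k : Multiset (X ⊕ X)) (b : Products B) :
    hB.act v (m + k) b = hB.act v m (hB.act v k b) :=
  haveI := hB.leftCommutative v
  Multiset.foldr_add _ _ _ _

theorem IsBicommutative.act_singleton (v : X → B) (a : X ⊕ X) (b : Products B) :
    hB.act v {a} b = sideMul v a b :=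
  haveI := hB.leftCommutative v
  Multiset.foldr_singleton _ _ _

/-- On products, `(uw)b = (ub)w` and `b(uw) = u(bw)`, so multiplying by a word amounts to
multiplying by its leaves, each from its own side. -/
theorem IsBicommutative.act_sides (v : X → B) (w : FreeMagma X) (b : Products B) :
    (hB.act v (sides true w) b).1 = FreeMagma.lift v w * b.1 ∧
      (hB.act v (sides false w) b).1 = b.1 * FreeMagma.lift v w := by
  induction w generalizing b with
  | ih1 a =>
    rw [sides_true_of, sides_false_of, hB.act_singleton, hB.act_singleton]
    exact ⟨rfl, rfl⟩
  | ih2 u w hu hw =>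
    rw [sides_mul, sides_mul]
    constructor
    · rw [add_comm, hB.act_add, (hw _).2, (hu _).1, map_mul, hB.right_comm]
    · rw [hB.act_add, (hu _).1, (hw _).2, map_mul, hB.left_comm]

theorem IsBicommutative.exists_lift_mul_eq_act (v : X → B) (u w : FreeMagma X) :
    ∃ i j t, sides true (u * w) = {Sum.inl i} + {Sum.inr j} + t ∧
      FreeMagma.lift v (u * w) = (hB.act v t ⟨v i * v j, _, _, rfl⟩).1 := by
  -- For a composite word the tags do not depend on the Boolean, which lets a composite right factor
  -- be used in the induction. The seed `x_i x_j` comes from the left factor if that is composite,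
  -- otherwise from the right one.
  have hcomp : ∀ z : FreeMagma X, (∃ i, z = .of i) ∨ (∀ s, sides s z = sides true z) ∧
      ∃ i j t, sides true z = {Sum.inl i} + {Sum.inr j} + t ∧
        FreeMagma.lift v z = (hB.act v t ⟨v i * v j, _, _, rfl⟩).1 := by
    intro z
    induction z with
    | ih1 a => exact Or.inl ⟨a, rfl⟩
    | ih2 u w hu hw =>
      refine Or.inr ⟨fun s => by rw [sides_mul, sides_mul], ?_⟩
      rcases hu with ⟨a, rfl⟩ | ⟨hs, i, j, t, hk, hl⟩
      · rcases hw with ⟨b, rfl⟩ | ⟨hs, i, j, t, hk, hl⟩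
        · exact ⟨a, b, 0, by simp, by
            have := hB.leftCommutative v
            simp [IsBicommutative.act]⟩
        · refine ⟨i, j, sides true (.of a) + t, ?_, ?_⟩
          · rw [sides_mul, hs, hk]; abel
          · rw [map_mul, hl, hB.act_add, (hB.act_sides v _ _).1]
      · refine ⟨i, j, sides false w + t, ?_, ?_⟩
        · rw [sides_mul, hk]; abel
        · rw [map_mul, hl, hB.act_add, (hB.act_sides v _ _).2]
  rcases hcomp (u * w) with ⟨i, h⟩ | ⟨-, h⟩
  · cases h
  · exact h

/-- The choice of the seed `x_i x_j` is immaterial: left-commutativity exchanges its left letter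
with any left-tagged leaf, right-commutativity its right letter with any right-tagged one. -/
theorem IsBicommutative.act_congr (v : X → B) {i j i' j' : X} {t t' : Multiset (X ⊕ X)}
    (h : ({Sum.inl i} + {Sum.inr j} + t : Multiset (X ⊕ X)) = {Sum.inl i'} + {Sum.inr j'} + t') :
    hB.act v t ⟨v i * v j, _, _, rfl⟩ = hB.act v t' ⟨v i' * v j', _, _, rfl⟩ := by
  have hi : Sum.inl i' = (Sum.inl i : X ⊕ X) ∨ Sum.inl i' ∈ t := by
    have : Sum.inl i' ∈ ({Sum.inl i} + {Sum.inr j} + t : Multiset (X ⊕ X)) := by rw [h]; simp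
    simpa using this
  have hj : Sum.inr j' = (Sum.inr j : X ⊕ X) ∨ Sum.inr j' ∈ t := by
    have : Sum.inr j' ∈ ({Sum.inl i} + {Sum.inr j} + t : Multiset (X ⊕ X)) := by rw [h]; simp
    simpa using this
  have left_swap : ∀ (i i' j : X) (s : Multiset (X ⊕ X)),
      hB.act v (s + {Sum.inl i'}) ⟨v i * v j, _, _, rfl⟩ =
        hB.act v (s + {Sum.inl i}) ⟨v i' * v j, _, _, rfl⟩ := by
    intro i i' j s
    rw [hB.act_add, hB.act_add, hB.act_singleton, hB.act_singleton]
    exact congrArg _ (Subtype.ext (hB.left_comm _ _ _))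
  have right_swap : ∀ (i j j' : X) (s : Multiset (X ⊕ X)),
      hB.act v (s + {Sum.inr j'}) ⟨v i * v j, _, _, rfl⟩ =
        hB.act v (s + {Sum.inr j}) ⟨v i * v j', _, _, rfl⟩ := by
    intro i j j' s
    rw [hB.act_add, hB.act_add, hB.act_singleton, hB.act_singleton]
    exact congrArg _ (Subtype.ext (hB.right_comm _ _ _))
  rcases hi with hi | hi
  · obtain rfl := Sum.inl_injective hi
    rcases hj with hj | hj
    · obtain rfl := Sum.inr_injective hj
      rw [add_left_cancel h]
    · obtain ⟨s, rfl⟩ := Multiset.exists_cons_of_mem hj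
      have ht : t' = s + {Sum.inr j} := by
        apply add_left_cancel (a := ({Sum.inl i'} + {Sum.inr j'} : Multiset (X ⊕ X)))
        rw [← h, ← Multiset.singleton_add]; abel
      rw [ht, ← Multiset.singleton_add, add_comm, right_swap]
  · obtain ⟨s, rfl⟩ := Multiset.exists_cons_of_mem hi
    rw [← Multiset.singleton_add, add_comm, left_swap]
    rcases hj with hj | hj
    · obtain rfl := Sum.inr_injective hj
      have ht : t' = s + {Sum.inl i} := by
        apply add_left_cancel (a := ({Sum.inl i'} + {Sum.inr j'} : Multiset (X ⊕ X)))
        rw [← h, ← Multiset.singleton_add]; abel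
      rw [ht]
    · rw [Multiset.mem_cons, or_iff_right (by simp)] at hj
      obtain ⟨s, rfl⟩ := Multiset.exists_cons_of_mem hj
      have ht : t' = s + {Sum.inl i} + {Sum.inr j} := by
        apply add_left_cancel (a := ({Sum.inl i'} + {Sum.inr j'} : Multiset (X ⊕ X)))
        rw [← h, ← Multiset.singleton_add, ← Multiset.singleton_add]; abel
      rw [ht, ← right_swap, ← Multiset.singleton_add]
      congr 1; abel

/-- In a bicommutative algebra the value of a word of degree at least two depends only on its tagged
leaves. -/
theorem IsBicommutative.lift_mul_congr (v : X → B) {u w u' w' : FreeMagma X}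
    (h : sides true (u * w) = sides true (u' * w')) :
    FreeMagma.lift v (u * w) = FreeMagma.lift v (u' * w') := by
  obtain ⟨i, j, t, h1, h2⟩ := hB.exists_lift_mul_eq_act v u w
  obtain ⟨i', j', t', h1', h2'⟩ := hB.exists_lift_mul_eq_act v u' w'
  rw [h2, h2', hB.act_congr v (h1.symm.trans (h.trans h1'))]

theorem IsBicommutative.lift_mul_eq_zero_of_left (h0 : ∀ a b c : B, a * (b * c) = 0) (v : X → B)
    {u w : FreeMagma X} (h : 1 < leftCount (sides true (u * w))) :
    FreeMagma.lift v (u * w) = 0 := by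
  obtain ⟨i, j, t, h1, h2⟩ := hB.exists_lift_mul_eq_act v u w
  rw [h1, leftCount_add, leftCount_add, leftCount_inl, leftCount_inr, add_zero,
    lt_add_iff_pos_right] at h
  -- A left leaf other than that of the seed can be applied last, giving `a(cd)`.
  obtain ⟨a | a, ha, ha'⟩ := Multiset.countP_pos.1 h
  · obtain ⟨s, rfl⟩ := Multiset.exists_cons_of_mem ha
    rw [h2, ← Multiset.singleton_add, hB.act_add, hB.act_singleton]
    obtain ⟨_, c, d, rfl⟩ := hB.act v s ⟨v i * v j, _, _, rfl⟩
    exact h0 _ _ _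
  · simp at ha'

theorem IsBicommutative.lift_mul_eq_zero_of_right (h0 : ∀ a b c : B, a * b * c = 0) (v : X → B)
    {u w : FreeMagma X} (h : 1 < rightCount (sides true (u * w))) :
    FreeMagma.lift v (u * w) = 0 := by
  obtain ⟨i, j, t, h1, h2⟩ := hB.exists_lift_mul_eq_act v u w
  rw [h1, rightCount_add, rightCount_add, rightCount_inl, rightCount_inr, zero_add,
    lt_add_iff_pos_right] at h
  obtain ⟨a | a, ha, ha'⟩ := Multiset.countP_pos.1 h
  · simp at ha'
  · obtain ⟨s, rfl⟩ := Multiset.exists_cons_of_mem ha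
    rw [h2, ← Multiset.singleton_add, hB.act_add, hB.act_singleton]
    obtain ⟨_, c, d, rfl⟩ := hB.act v s ⟨v i * v j, _, _, rfl⟩
    exact h0 _ _ _

end Bicommutative

/-! ## Identities of the two-dimensional algebras -/

section Lift

variable {K X B : Type*} [Field K] [NonUnitalNonAssocRing B] [Module K B] [IsScalarTower K B B]
  [SMulCommClass K B B]

theorem lift_eq_sum (v : X → B) (f : FreeNonUnitalNonAssocAlgebra K X) :
    FreeNonUnitalNonAssocAlgebra.lift K v f =
      f.coeff.sum fun w c => c • FreeMagma.lift v w := rfl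

theorem lift_ofMagma (v : X → B) (w : FreeMagma X) :
    FreeNonUnitalNonAssocAlgebra.lift K v (MonoidAlgebra.ofMagma K _ w) = FreeMagma.lift v w := by
  rw [lift_eq_sum]
  simp [MonoidAlgebra.ofMagma, Finsupp.sum_single_index]

end Lift

namespace TwoDim

variable {K : Type*} [Field K] {π ϱ : K} {X : Type*}

/-- The linear form `a + ϱ b`, which describes the multiplication by `a r + b r²` from the left. -/
def leftForm (u : TwoDim π ϱ) : K := u.a + ϱ * u.b

/-- The linear form `a + π b`, which describes the multiplication by `a r + b r²` from the right. -/
def rightForm (u : TwoDim π ϱ) : K := u.a + π * u.b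

theorem mul_b_eq (u v : TwoDim π ϱ) : (u * v).b = leftForm u * rightForm v := by
  rw [mul_b, leftForm, rightForm]; ring

/-- The scalar by which the words with the tagged leaves `m` are multiplied in `A_{π,ϱ}`. -/
def weight (π ϱ : K) (m : Multiset (X ⊕ X)) : K := π ^ (leftCount m - 1) * ϱ ^ (rightCount m - 1)

/-- The value of the linear form given by the tag. -/
def sideForm (v : X → TwoDim π ϱ) : X ⊕ X → K :=
  Sum.elim (fun i => leftForm (v i)) fun i => rightForm (v i)

/-- The two forms are computed together because the left form of a product needs the right form of
its second factor. On a product the left form contributes one extra `ϱ` and the right form one extra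
`π`. -/
theorem forms_lift (v : X → TwoDim π ϱ) (w : FreeMagma X) :
    leftForm (FreeMagma.lift v w) = π ^ (leftCount (sides true w) - 1) *
        ϱ ^ rightCount (sides true w) * ((sides true w).map (sideForm v)).prod ∧
      rightForm (FreeMagma.lift v w) = π ^ leftCount (sides false w) *
        ϱ ^ (rightCount (sides false w) - 1) * ((sides false w).map (sideForm v)).prod := by
  induction w with
  | ih1 a => simp [sideForm]
  | ih2 u w hu hw =>
    obtain ⟨p, hp⟩ := Nat.exists_eq_succ_of_ne_zero (leftCount_pos u).ne'
    obtain ⟨q, hq⟩ := Nat.exists_eq_succ_of_ne_zero (rightCount_pos w).ne'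
    have hb := mul_b_eq (FreeMagma.lift v u) (FreeMagma.lift v w)
    rw [hu.1, hw.2, hp, hq] at hb
    rw [map_mul, leftForm, rightForm, hb]
    simp only [mul_a, sides_mul, leftCount_add, rightCount_add, Multiset.map_add,
      Multiset.prod_add, hp, hq]
    have h1 : p.succ + leftCount (sides false w) - 1 = p + leftCount (sides false w) := by omega
    have h2 : rightCount (sides true u) + q.succ - 1 = rightCount (sides true u) + q := by omega
    rw [h1, h2]
    simp only [Nat.succ_sub_one, Nat.succ_eq_add_one]
    constructor <;> ring

theorem lift_mul_b (v : X → TwoDim π ϱ) (u w : FreeMagma X) :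
    (FreeMagma.lift v (u * w)).b = weight π ϱ (sides true (u * w)) *
      ((sides true (u * w)).map (sideForm v)).prod := by
  obtain ⟨p, hp⟩ := Nat.exists_eq_succ_of_ne_zero (leftCount_pos u).ne'
  obtain ⟨q, hq⟩ := Nat.exists_eq_succ_of_ne_zero (rightCount_pos w).ne'
  rw [map_mul, mul_b_eq, (forms_lift v u).1, (forms_lift v w).2, weight, hp, hq]
  simp only [sides_mul, leftCount_add, rightCount_add, Multiset.map_add, Multiset.prod_add, hp, hq]
  have h1 : p.succ + leftCount (sides false w) - 1 = p + leftCount (sides false w) := by omega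
  have h2 : rightCount (sides true u) + q.succ - 1 = rightCount (sides true u) + q := by omega
  rw [h1, h2]
  simp only [Nat.succ_sub_one]
  ring

theorem lift_mul_a (v : X → TwoDim π ϱ) (u w : FreeMagma X) :
    (FreeMagma.lift v (u * w)).a = 0 := by
  rw [map_mul, mul_a]

variable (π ϱ) in
theorem isBicommutative : IsBicommutative (TwoDim π ϱ) where
  right_comm a b c := by ext <;> simp; ring
  left_comm a b c := by ext <;> simp; ring

/-- For `π ≠ ϱ` the two linear forms are independent. -/
theorem exists_forms_eq (h : π ≠ ϱ) (s t : K) :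
    ∃ u : TwoDim π ϱ, leftForm u = s ∧ rightForm u = t := by
  have h' : ϱ - π ≠ 0 := sub_ne_zero.2 h.symm
  refine ⟨⟨(ϱ * t - π * s) / (ϱ - π), (s - t) / (ϱ - π)⟩, ?_, ?_⟩ <;>
    simp only [leftForm, rightForm] <;> field_simp <;> ring

theorem exists_sideForm_eq (h : π ≠ ϱ) (y : X ⊕ X → K) :
    ∃ v : X → TwoDim π ϱ, sideForm v = y := by
  choose v hv using fun i => exists_forms_eq h (y (Sum.inl i)) (y (Sum.inr i))
  refine ⟨v, funext ?_⟩
  rintro (i | i)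
  · exact (hv i).1
  · exact (hv i).2

/-- The coordinate at `r` as a linear map. -/
def aLin (π ϱ : K) : TwoDim π ϱ →ₗ[K] K where
  toFun u := u.a
  map_add' _ _ := rfl
  map_smul' _ _ := rfl

/-- The coordinate at `r²` as a linear map. -/
def bLin (π ϱ : K) : TwoDim π ϱ →ₗ[K] K where
  toFun u := u.b
  map_add' _ _ := rfl
  map_smul' _ _ := rfl

theorem coeff_of_eq_zero {f : FreeNonUnitalNonAssocAlgebra K X}
    (hf : f ∈ identities K X (TwoDim π ϱ)) (i : X) : f.coeff (FreeMagma.of i) = 0 := by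
  classical
  -- Products have no `r`-coordinate, so `x_i ↦ r` with all other variables sent to `0` isolates
  -- this coefficient.
  have h := congrArg (aLin π ϱ) (hf (fun j => if j = i then r π ϱ else 0))
  rw [lift_eq_sum, map_finsuppSum, map_zero, Finsupp.sum,
    Finset.sum_eq_single (FreeMagma.of i)] at h
  · simpa [aLin, r] using h
  · intro w _ hw
    induction w with
    | ih1 j =>
      have hj : j ≠ i := fun hj => hw (congrArg _ hj)
      simp [hj]
    | ih2 u w =>
      rw [map_smul]
      exact mul_eq_zero_of_right (f.coeff (u * w))
        (lift_mul_a (fun j => if j = i then r π ϱ else 0) u w)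
  · intro h
    rw [Finsupp.notMem_support_iff.1 h, zero_smul, map_zero]

/-- The values of the forms at the variables can be prescribed arbitrarily, so the `r²`-coordinate
of `f` is a polynomial function that vanishes everywhere; its coefficients are the weighted sums of
the coefficients of `f` over words with equal tags. -/
theorem weight_mul_coeff_eq_zero [Infinite K] (h : π ≠ ϱ)
    {f : FreeNonUnitalNonAssocAlgebra K X} (hf : f ∈ identities K X (TwoDim π ϱ))
    (m : Multiset (X ⊕ X)) : weight π ϱ m * f.coeff.mapDomain (sides true) m = 0 := by
  classical
  set p : MvPolynomial (X ⊕ X) K := (f.coeff.mapDomain (sides true)).sum fun k c =>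
    MvPolynomial.monomial (Multiset.toFinsupp k) (weight π ϱ k * c) with hp
  have hp0 : p = 0 := by
    apply MvPolynomial.funext
    intro y
    obtain ⟨v, rfl⟩ := exists_sideForm_eq h y
    have h0 := congrArg (bLin π ϱ) (hf v)
    rw [lift_eq_sum, map_finsuppSum, map_zero] at h0
    rw [map_zero, hp, Finsupp.sum_mapDomain_index (by simp) (by simp [mul_add]), map_finsuppSum,
      ← h0]
    refine Finsupp.sum_congr fun w _ => ?_
    induction w with
    | ih1 i => simp [coeff_of_eq_zero hf]
    | ih2 u w =>
      rw [MvPolynomial.eval_monomial, map_smul]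
      change _ = _ * (FreeMagma.lift v (u * w)).b
      rw [lift_mul_b, Finsupp.prod, Multiset.toFinsupp_support, Finset.prod_multiset_map_count]
      simp only [Multiset.toFinsupp_apply]
      ring
  have hc := congrArg (MvPolynomial.coeff (Multiset.toFinsupp m)) hp0
  rw [hp, Finsupp.sum, MvPolynomial.coeff_sum, Finset.sum_eq_single m] at hc
  · simpa using hc
  · intro k _ hk
    rw [MvPolynomial.coeff_monomial, if_neg]
    exact fun h => hk (Multiset.toFinsupp.injective h)
  · intro hm
    rw [Finsupp.notMem_support_iff.1 hm, mul_zero, map_zero, MvPolynomial.coeff_zero]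

/-- A bicommutative algebra in which every word vanishes that vanishes in `A_{π,ϱ}` belongs to the
variety generated by `A_{π,ϱ}`. -/
theorem identities_le [Infinite K] (h : π ≠ ϱ) {B : Type*} [NonUnitalNonAssocRing B] [Module K B]
    [IsScalarTower K B B] [SMulCommClass K B B] (hB : IsBicommutative B)
    (h0 : ∀ (v : X → B) (u w : FreeMagma X), weight π ϱ (sides true (u * w)) = 0 →
      FreeMagma.lift v (u * w) = 0) :
    identities K X (TwoDim π ϱ) ≤ identities K X B := by
  classical
  intro f hf v
  -- The common value of all composite words with the tags `m`; the default `0` serves multisets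
  -- that no composite word realizes.
  let G : Multiset (X ⊕ X) → B := fun m =>
    if hm : ∃ p : FreeMagma X × FreeMagma X, sides true (p.1 * p.2) = m then
      FreeMagma.lift v (hm.choose.1 * hm.choose.2) else 0
  have hG : ∀ u w : FreeMagma X, FreeMagma.lift v (u * w) = G (sides true (u * w)) := by
    intro u w
    have hm : ∃ p : FreeMagma X × FreeMagma X, sides true (p.1 * p.2) = sides true (u * w) :=
      ⟨(u, w), rfl⟩
    simp only [G, dif_pos hm]
    exact hB.lift_mul_congr v hm.choose_spec.symm
  have hsum : FreeNonUnitalNonAssocAlgebra.lift K v f =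
      (f.coeff.mapDomain (sides true)).sum fun m c => c • G m := by
    rw [lift_eq_sum, Finsupp.sum_mapDomain_index (by simp) (by simp [add_smul])]
    refine Finsupp.sum_congr fun w _ => ?_
    induction w with
    | ih1 i => simp [coeff_of_eq_zero hf]
    | ih2 u w => rw [hG]
  rw [hsum]
  refine Finset.sum_eq_zero fun m _ => ?_
  rcases mul_eq_zero.1 (weight_mul_coeff_eq_zero h hf m) with hm | hm
  · have : G m = 0 := by
      by_cases hp : ∃ p : FreeMagma X × FreeMagma X, sides true (p.1 * p.2) = m
      · simp only [G, dif_pos hp]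
        exact h0 _ _ _ (by rw [hp.choose_spec, hm])
      · simp only [G, dif_neg hp]
    simp only [this, smul_zero]
  · simp only [hm, zero_smul]

end TwoDim

/-! ## The generated varieties -/

section Varieties

variable {K : Type*} [Field K] {B : Type*} [NonUnitalNonAssocRing B] [Module K B]
  [IsScalarTower K B B] [SMulCommClass K B B]

@[simp] theorem lift_x (v : ℕ → B) (i : ℕ) :
    FreeNonUnitalNonAssocAlgebra.lift K v (x K i) = v i :=
  FreeNonUnitalNonAssocAlgebra.lift_of_apply K v i

/-- The substitution of three elements for the variables `x₁, x₂, x₃`. -/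
def substitution (a b c : B) : ℕ → B
  | 1 => a
  | 2 => b
  | _ => c

theorem inVariety_bicommutativity_iff :
    InVariety (bicommutativity K) B ↔ IsBicommutative B := by
  constructor
  · intro h
    constructor
    · intro a b c
      have := h _ (Or.inl rfl) (substitution a b c)
      simpa [substitution, sub_eq_zero] using this
    · intro a b c
      have := h _ (Or.inr rfl) (substitution a b c)
      simpa [substitution, sub_eq_zero] using this
  · rintro h f (rfl | rfl) v
    · simp [h.right_comm (v 1) (v 2) (v 3)]
    · simp [h.left_comm (v 1) (v 2) (v 3)]

theorem inVariety_leftNilpotency_iff :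
    InVariety {leftNilpotency K} B ↔ ∀ a b c : B, a * (b * c) = 0 := by
  constructor
  · intro h a b c
    simpa [leftNilpotency, substitution] using h _ rfl (substitution a b c)
  · rintro h f rfl v
    simp [leftNilpotency, h]

theorem inVariety_rightNilpotency_iff :
    InVariety {rightNilpotency K} B ↔ ∀ a b c : B, a * b * c = 0 := by
  constructor
  · intro h a b c
    simpa [rightNilpotency, substitution] using h _ rfl (substitution a b c)
  · rintro h f rfl v
    simp [rightNilpotency, h]

/-- An algebra of the variety generated by `A` satisfies the identities of `A`. -/
theorem InVarietyGeneratedBy.inVariety {A : Type*} [NonUnitalNonAssocRing A] [Module K A]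
    [IsScalarTower K A A] [SMulCommClass K A A] (h : InVarietyGeneratedBy K A B)
    {S : Set (FreeNonUnitalNonAssocAlgebra K ℕ)} (hS : InVariety S A) : InVariety S B :=
  fun f hf => h f (hS f hf)

theorem inVarietyGeneratedBy_zero_one [Infinite K] :
    InVarietyGeneratedBy K (TwoDim (0 : K) 1) B ↔
      InVariety (bicommutativity K) B ∧ InVariety {leftNilpotency K} B := by
  constructor
  · intro h
    refine ⟨h.inVariety (inVariety_bicommutativity_iff.2 (TwoDim.isBicommutative _ _)),
      h.inVariety (inVariety_leftNilpotency_iff.2 fun a b c => ?_)⟩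
    ext <;> simp
  · rintro ⟨hB, h0⟩
    rw [inVariety_bicommutativity_iff] at hB
    rw [inVariety_leftNilpotency_iff] at h0
    refine TwoDim.identities_le zero_ne_one hB fun v u w hw => ?_
    refine hB.lift_mul_eq_zero_of_left h0 v ?_
    by_contra hc
    -- With at most one left leaf the weight is `0 ^ 0 = 1`.
    rw [TwoDim.weight, Nat.sub_eq_zero_of_le (not_lt.1 hc)] at hw
    simp at hw

theorem inVarietyGeneratedBy_one_zero [Infinite K] :
    InVarietyGeneratedBy K (TwoDim (1 : K) 0) B ↔
      InVariety (bicommutativity K) B ∧ InVariety {rightNilpotency K} B := by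
  constructor
  · intro h
    refine ⟨h.inVariety (inVariety_bicommutativity_iff.2 (TwoDim.isBicommutative _ _)),
      h.inVariety (inVariety_rightNilpotency_iff.2 fun a b c => ?_)⟩
    ext <;> simp
  · rintro ⟨hB, h0⟩
    rw [inVariety_bicommutativity_iff] at hB
    rw [inVariety_rightNilpotency_iff] at h0
    refine TwoDim.identities_le one_ne_zero hB fun v u w hw => ?_
    refine hB.lift_mul_eq_zero_of_right h0 v ?_
    by_contra hc
    rw [TwoDim.weight, Nat.sub_eq_zero_of_le (not_lt.1 hc)] at hw
    simp at hw

theorem inVarietyGeneratedBy_one_neg_one [CharZero K] :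
    InVarietyGeneratedBy K (TwoDim (1 : K) (-1)) B ↔ InVariety (bicommutativity K) B := by
  constructor
  · intro h
    exact h.inVariety (inVariety_bicommutativity_iff.2 (TwoDim.isBicommutative _ _))
  · intro hB
    rw [inVariety_bicommutativity_iff] at hB
    have h : (1 : K) ≠ -1 := by norm_num
    refine TwoDim.identities_le h hB fun v u w hw => ?_
    simp [TwoDim.weight] at hw

end Varieties

/-! ## Multilinear polynomials with a basis permuted by the symmetric group -/

/-- The trace of an endomorphism that permutes a basis is the number of the fixed basis vectors. -/
theorem trace_eq_sum_of_permutes {K M ι : Type*} [Field K] [AddCommGroup M] [Module K M] [Fintype ι]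
    [DecidableEq ι] (b : Module.Basis ι K M) (σ : ι → ι) (f : M →ₗ[K] M)
    (h : ∀ i, f (b i) = b (σ i)) : LinearMap.trace K M f = ∑ i, if σ i = i then 1 else 0 := by
  rw [LinearMap.trace_eq_matrix_trace K b, Matrix.trace]
  refine Finset.sum_congr rfl fun i _ => ?_
  rw [Matrix.diag_apply, LinearMap.toMatrix_apply, h, Module.Basis.repr_self, Finsupp.single_apply]

section PermutationBasis

variable (K : Type*) [Field K]
  (A : Type*) [NonUnitalNonAssocRing A] [Module K A] [IsScalarTower K A A] [SMulCommClass K A A]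
  {n : ℕ}

/-- The class of a word in the relatively free algebra. -/
def wordClass (w : FreeMagma (Fin n)) : RelFree K A n :=
  (identities K (Fin n) A).mkQ (MonoidAlgebra.ofMagma K _ w)

variable {K A}

theorem wordClass_eq_iff {u w : FreeMagma (Fin n)} :
    wordClass K A u = wordClass K A w ↔
      ∀ v : Fin n → A, FreeMagma.lift v u = FreeMagma.lift v w := by
  rw [wordClass, wordClass, Submodule.mkQ_apply, Submodule.mkQ_apply, Submodule.Quotient.eq]
  refine forall_congr' fun v => ?_
  rw [map_sub, lift_ofMagma, lift_ofMagma, sub_eq_zero]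

theorem wordClass_eq_zero_iff {w : FreeMagma (Fin n)} :
    wordClass K A w = 0 ↔ ∀ v : Fin n → A, FreeMagma.lift v w = 0 := by
  rw [wordClass, Submodule.mkQ_apply, Submodule.Quotient.mk_eq_zero]
  refine forall_congr' fun v => ?_
  rw [lift_ofMagma]

theorem wordClass_mem {w : FreeMagma (Fin n)} (h : letters w = Finset.univ.val) :
    wordClass K A w ∈ relMultilinear K A n :=
  ⟨_, Submodule.subset_span ⟨w, h, rfl⟩, rfl⟩

theorem relMultilinear_eq_span : relMultilinear K A n =
    Submodule.span K {f | ∃ w, letters w = Finset.univ.val ∧ f = wordClass K A w} := by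
  rw [relMultilinear, multilinear, Submodule.map_span]
  congr 1
  ext f
  constructor
  · rintro ⟨_, ⟨w, hw, rfl⟩, rfl⟩
    exact ⟨w, hw, rfl⟩
  · rintro ⟨w, hw, rfl⟩
    exact ⟨_, ⟨w, hw, rfl⟩, rfl⟩

theorem relPermuteVars_wordClass (σ : Equiv.Perm (Fin n)) (w : FreeMagma (Fin n)) :
    relPermuteVars K A n σ (wordClass K A w) = wordClass K A (FreeMagma.map σ w) := by
  rw [wordClass, wordClass, ← permuteVars_word]
  rfl

/-- If the multilinear words are, modulo the identities of `A`, either zero or one of `n` linearly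
independent words `w i` that are permuted like the variables, then these words form a basis of the
multilinear component of the relatively free algebra. -/
theorem exists_permuted_basis (w : Fin n → FreeMagma (Fin n))
    (hw : ∀ i, letters (w i) = Finset.univ.val)
    (hspan : ∀ u, letters u = Finset.univ.val →
      wordClass K A u = 0 ∨ ∃ i, wordClass K A u = wordClass K A (w i))
    (hind : LinearIndependent K fun i => wordClass K A (w i))
    (hperm : ∀ (σ : Equiv.Perm (Fin n)) i,
      wordClass K A (FreeMagma.map σ (w i)) = wordClass K A (w (σ i))) :
    ∃ b : Module.Basis (Fin n) K (relMultilinear K A n),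
      ∀ σ i, multilinearRep K A n σ (b i) = b (σ i) := by
  have hrange : Submodule.span K (Set.range fun i => wordClass K A (w i)) =
      relMultilinear K A n := by
    apply le_antisymm
    · rw [Submodule.span_le]
      rintro _ ⟨i, rfl⟩
      exact wordClass_mem (hw i)
    · rw [relMultilinear_eq_span, Submodule.span_le]
      rintro _ ⟨u, hu, rfl⟩
      rcases hspan u hu with h | ⟨i, h⟩
      · rw [h]; exact zero_mem _
      · rw [h]; exact Submodule.subset_span ⟨i, rfl⟩
  let b := (Module.Basis.span hind).map (LinearEquiv.ofEq _ _ hrange)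
  have hb : ∀ i, (b i : RelFree K A n) = wordClass K A (w i) := by
    intro i
    simp [b, Module.Basis.span_apply]
  refine ⟨b, fun σ i => Subtype.ext ?_⟩
  change relPermuteVars K A n σ (b i) = b (σ i)
  rw [hb, hb, relPermuteVars_wordClass, hperm]

theorem codimension_eq_of_basis (b : Module.Basis (Fin n) K (relMultilinear K A n)) :
    codimension K A n = n := by
  rw [codimension, Module.finrank_eq_card_basis b, Fintype.card_fin]

theorem cocharacter_eq_of_basis (b : Module.Basis (Fin n) K (relMultilinear K A n))
    (hb : ∀ σ i, multilinearRep K A n σ (b i) = b (σ i)) :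
    cocharacter K A n = fun σ => ∑ i, if σ i = i then 1 else 0 :=
  funext fun σ => trace_eq_sum_of_permutes b σ _ (hb σ)

end PermutationBasis

/-! ## The multilinear components for the algebras `A_{0,1}` and `A_{1,0}` -/

section TwoDimBasis

variable {K : Type*} [Field K] {π ϱ : K} {n : ℕ}

/-- The keys are the tag multisets of the multilinear words that survive in `A_{π,ϱ}`; `hsep`
supplies, for each key, values of the forms that single it out. -/
theorem exists_permuted_basis_of_keys (h : π ≠ ϱ) (key : Fin n → Multiset (Fin n ⊕ Fin n))
    (hword : ∀ i, ∃ u w, sides true (u * w) = key i)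
    (hweight : ∀ i, TwoDim.weight π ϱ (key i) = 1)
    (hletters : ∀ i, (key i).map (Sum.elim id id) = Finset.univ.val)
    (hkey : ∀ m : Multiset (Fin n ⊕ Fin n), 0 < leftCount m → 0 < rightCount m →
      m.map (Sum.elim id id) = Finset.univ.val → TwoDim.weight π ϱ m = 0 ∨ ∃ i, m = key i)
    (hsep : ∀ i, ∃ y : Fin n ⊕ Fin n → K, ∀ j, ((key j).map y).prod = if j = i then 1 else 0)
    (hperm : ∀ (σ : Equiv.Perm (Fin n)) i, (key i).map (Sum.map σ σ) = key (σ i))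
    (hn : 2 ≤ n) :
    ∃ b : Module.Basis (Fin n) K (relMultilinear K (TwoDim π ϱ) n),
      ∀ σ i, multilinearRep K (TwoDim π ϱ) n σ (b i) = b (σ i) := by
  choose u w huw using hword
  have hB := TwoDim.isBicommutative π ϱ
  refine exists_permuted_basis (fun i => u i * w i) ?_ ?_ ?_ ?_
  · intro i
    rw [letters_eq_map_sides true, huw, hletters]
  · intro z hz
    induction z with
    | ih1 a =>
      have := congrArg Multiset.card hz
      rw [Finset.card_val, Finset.card_fin] at this
      change 1 = n at this
      omega
    | ih2 p q =>
      have h1 : 0 < leftCount (sides true (p * q)) := by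
        rw [sides_mul, leftCount_add]
        exact Nat.add_pos_left (leftCount_pos p) _
      have h2 : 0 < rightCount (sides true (p * q)) := by
        rw [sides_mul, rightCount_add]
        exact Nat.add_pos_right _ (rightCount_pos q)
      rw [letters_eq_map_sides true] at hz
      rcases hkey _ h1 h2 hz with h0 | ⟨i, hi⟩
      · refine Or.inl (wordClass_eq_zero_iff.2 fun v => ?_)
        ext
        · exact TwoDim.lift_mul_a v p q
        · rw [TwoDim.lift_mul_b, h0, zero_mul, TwoDim.zero_b]
      · exact Or.inr ⟨i, wordClass_eq_iff.2 fun v => hB.lift_mul_congr v (hi.trans (huw i).symm)⟩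
  · rw [Fintype.linearIndependent_iff]
    intro c hc i
    obtain ⟨y, hy⟩ := hsep i
    obtain ⟨v, hv⟩ := TwoDim.exists_sideForm_eq h y
    -- A linear relation between the classes is an identity of the algebra; under `v` only the
    -- `i`-th word survives, with coordinate `1` at `r²`.
    have hmem : ∑ j, c j • MonoidAlgebra.ofMagma K _ (u j * w j) ∈
        identities K (Fin n) (TwoDim π ϱ) := by
      rw [← Submodule.Quotient.mk_eq_zero, ← Submodule.mkQ_apply, map_sum]
      simp only [map_smul]
      exact hc
    have h0 := congrArg (TwoDim.bLin π ϱ) (hmem v)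
    have hval : ∀ j, TwoDim.bLin π ϱ (FreeMagma.lift v (u j * w j)) = if j = i then 1 else 0 := by
      intro j
      change (FreeMagma.lift v (u j * w j)).b = _
      rw [TwoDim.lift_mul_b, huw, hweight, hv, hy, one_mul]
    simpa only [map_sum, map_smul, lift_ofMagma, hval, map_zero, smul_eq_mul, mul_ite, mul_one,
      mul_zero, Finset.sum_ite_eq', Finset.mem_univ, if_true] using h0
  · intro σ i
    refine wordClass_eq_iff.2 fun v => ?_
    rw [map_mul]
    refine hB.lift_mul_congr v ?_
    rw [← map_mul, sides_map, huw, huw, hperm]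

/-- The tagged leaves of a multilinear word whose only left leaf is `x_i`. -/
def leftKey (i : Fin n) : Multiset (Fin n ⊕ Fin n) :=
  {Sum.inl i} + (Finset.univ.erase i).val.map Sum.inr

/-- The tagged leaves of a multilinear word whose only right leaf is `x_i`. -/
def rightKey (i : Fin n) : Multiset (Fin n ⊕ Fin n) :=
  (leftKey i).map Sum.swap

theorem leftCount_map_swap {X : Type*} (m : Multiset (X ⊕ X)) :
    leftCount (m.map Sum.swap) = rightCount m := by
  rw [leftCount, rightCount, Multiset.countP_map, ← Multiset.countP_eq_card_filter]
  simp

theorem rightCount_map_swap {X : Type*} (m : Multiset (X ⊕ X)) :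
    rightCount (m.map Sum.swap) = leftCount m := by
  rw [leftCount, rightCount, Multiset.countP_map, ← Multiset.countP_eq_card_filter]
  simp

theorem map_swap_map_swap {X : Type*} (m : Multiset (X ⊕ X)) :
    (m.map Sum.swap).map Sum.swap = m := by
  simp

theorem map_swap_map_elim {X : Type*} (m : Multiset (X ⊕ X)) :
    (m.map Sum.swap).map (Sum.elim id id) = m.map (Sum.elim id id) := by
  rw [Multiset.map_map]
  congr 1
  funext a
  cases a <;> rfl

theorem leftCount_leftKey (i : Fin n) : leftCount (leftKey i) = 1 := by
  rw [leftKey, leftCount_add, leftCount_inl, Nat.add_eq_left, leftCount, Multiset.countP_eq_zero]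
  simp

theorem map_elim_leftKey (i : Fin n) :
    (leftKey i).map (Sum.elim id id) = Finset.univ.val := by
  rw [leftKey, Multiset.map_add, Multiset.map_map, Multiset.map_singleton]
  simp only [Sum.elim_comp_inr, Multiset.map_id, Sum.elim_inl, id]
  rw [Multiset.singleton_add, Finset.erase_val]
  exact Multiset.cons_erase (Finset.mem_univ_val i)

/-- Apart from the single left leaf all tags are `inr`, so the underlying letters determine the
rest. -/
theorem eq_leftKey_of_leftCount {m : Multiset (Fin n ⊕ Fin n)} (h1 : leftCount m = 1)
    (hm : m.map (Sum.elim id id) = Finset.univ.val) : ∃ i, m = leftKey i := by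
  have hpos : 0 < leftCount m := by omega
  obtain ⟨i | i, hi, hi'⟩ := Multiset.countP_pos.1 hpos
  · obtain ⟨s, rfl⟩ := Multiset.exists_cons_of_mem hi
    rw [← Multiset.singleton_add] at h1
    rw [leftCount_add, leftCount_inl, Nat.add_eq_left, leftCount, Multiset.countP_eq_zero] at h1
    have hs : s = (s.map (Sum.elim id id)).map Sum.inr := by
      rw [Multiset.map_map]
      conv_lhs => rw [← Multiset.map_id s]
      refine Multiset.map_congr rfl fun a ha => ?_
      rcases a with a | a
      · exact absurd rfl (h1 _ ha)
      · rfl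
    refine ⟨i, ?_⟩
    rw [leftKey, Finset.erase_val, ← hm, Multiset.map_cons, Sum.elim_inl, id,
      Multiset.erase_cons_head, ← hs, Multiset.singleton_add]
  · simp at hi'

/-- Relabelling preserves the number of left leaves and the full set of letters, so the image is
again some `leftKey j`; its left leaf shows `j = σ i`. -/
theorem leftKey_map (σ : Equiv.Perm (Fin n)) (i : Fin n) :
    (leftKey i).map (Sum.map σ σ) = leftKey (σ i) := by
  have h := eq_leftKey_of_leftCount (m := (leftKey i).map (Sum.map σ σ)) ?_ ?_
  · obtain ⟨j, hj⟩ := h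
    have : Sum.inl (σ i) ∈ leftKey j := by
      rw [← hj]
      exact Multiset.mem_map.2 ⟨Sum.inl i, by simp [leftKey], rfl⟩
    have hij : σ i = j := by simpa [leftKey] using this
    rw [hj, hij]
  · rw [← leftCount_leftKey i, leftCount, leftCount, Multiset.countP_map,
      ← Multiset.countP_eq_card_filter]
    simp
  · have h : (Sum.elim id id : Fin n ⊕ Fin n → Fin n) ∘ Sum.map σ σ = σ ∘ Sum.elim id id := by
      funext a
      cases a <;> rfl
    rw [Multiset.map_map, h, ← Multiset.map_map, map_elim_leftKey]
    have h := congrArg Finset.val (Finset.map_univ_equiv σ)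
    rwa [Finset.map_val] at h

theorem leftKey_prod (i j : Fin n) :
    ((leftKey j).map (Sum.elim (Pi.single i (1 : K)) fun k => if k = i then 0 else 1)).prod =
      if j = i then 1 else 0 := by
  rw [leftKey, Multiset.map_add, Multiset.prod_add, Multiset.map_map, Multiset.map_singleton,
    Multiset.prod_singleton, Sum.elim_inl, Sum.elim_comp_inr, Pi.single_apply]
  split_ifs with h
  · subst h
    rw [one_mul]
    refine Finset.prod_eq_one fun k hk => ?_
    rw [if_neg (Finset.ne_of_mem_erase hk)]
  · rw [zero_mul]

theorem exists_sides_eq_leftKey (hn : 2 ≤ n) (i : Fin n) :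
    ∃ u w : FreeMagma (Fin n), sides true (u * w) = leftKey i := by
  have : Nontrivial (Fin n) := Fin.nontrivial_iff_two_le.2 hn
  obtain ⟨j, hj⟩ := exists_ne i
  obtain ⟨s, hs⟩ := Multiset.exists_cons_of_mem
    (show j ∈ (Finset.univ.erase i).val from Finset.mem_erase.2 ⟨hj, Finset.mem_univ j⟩)
  obtain ⟨u, w, h⟩ := exists_mul_sides i j (s.map Sum.inr)
  refine ⟨u, w, ?_⟩
  rw [h, leftKey, hs, Multiset.map_cons, add_assoc, Multiset.singleton_add (Sum.inr j)]

theorem exists_sides_eq_rightKey (hn : 2 ≤ n) (i : Fin n) :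
    ∃ u w : FreeMagma (Fin n), sides true (u * w) = rightKey i := by
  have : Nontrivial (Fin n) := Fin.nontrivial_iff_two_le.2 hn
  obtain ⟨j, hj⟩ := exists_ne i
  obtain ⟨s, hs⟩ := Multiset.exists_cons_of_mem
    (show j ∈ (Finset.univ.erase i).val from Finset.mem_erase.2 ⟨hj, Finset.mem_univ j⟩)
  obtain ⟨u, w, h⟩ := exists_mul_sides j i (s.map Sum.inl)
  refine ⟨u, w, ?_⟩
  rw [h, rightKey, leftKey, hs, Multiset.map_cons, Multiset.map_add, Multiset.map_singleton,
    Multiset.map_cons, Multiset.map_map, ← Multiset.singleton_add (Sum.swap _)]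
  simp only [Sum.swap_inl, Sum.swap_inr]
  rw [← add_assoc, add_comm {Sum.inl j}]
  rfl

theorem exists_permuted_basis_zero_one (hn : 2 ≤ n) :
    ∃ b : Module.Basis (Fin n) K (relMultilinear K (TwoDim (0 : K) 1) n),
      ∀ σ i, multilinearRep K (TwoDim (0 : K) 1) n σ (b i) = b (σ i) := by
  refine exists_permuted_basis_of_keys zero_ne_one leftKey (exists_sides_eq_leftKey hn) ?_
    map_elim_leftKey ?_ (fun i => ⟨_, leftKey_prod i⟩) leftKey_map hn
  · intro i
    simp [TwoDim.weight, leftCount_leftKey]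
  · intro m h1 _ hm
    by_cases h : leftCount m = 1
    · exact Or.inr (eq_leftKey_of_leftCount h hm)
    · left
      rw [TwoDim.weight, zero_pow (by omega), zero_mul]

theorem exists_permuted_basis_one_zero (hn : 2 ≤ n) :
    ∃ b : Module.Basis (Fin n) K (relMultilinear K (TwoDim (1 : K) 0) n),
      ∀ σ i, multilinearRep K (TwoDim (1 : K) 0) n σ (b i) = b (σ i) := by
  refine exists_permuted_basis_of_keys one_ne_zero rightKey (exists_sides_eq_rightKey hn) ?_
    ?_ ?_ ?_ ?_ hn
  · intro i
    simp [TwoDim.weight, rightKey, rightCount_map_swap, leftCount_leftKey]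
  · intro i
    rw [rightKey, map_swap_map_elim, map_elim_leftKey]
  · intro m _ h2 hm
    by_cases h : rightCount m = 1
    · rw [← leftCount_map_swap] at h
      rw [← map_swap_map_elim] at hm
      obtain ⟨i, hi⟩ := eq_leftKey_of_leftCount h hm
      exact Or.inr ⟨i, by rw [rightKey, ← hi, map_swap_map_swap]⟩
    · left
      rw [TwoDim.weight, zero_pow (by omega), mul_zero]
  · intro i
    refine ⟨(Sum.elim (Pi.single i (1 : K)) fun k => if k = i then 0 else 1) ∘ Sum.swap,
      fun j => ?_⟩
    rw [rightKey, Multiset.map_map, Function.comp_assoc, ← leftKey_prod i j]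
    simp
  · intro σ i
    rw [rightKey, rightKey, ← leftKey_map, Multiset.map_map, Multiset.map_map]
    congr 1
    funext a
    cases a <;> rfl

/-- In degree one the multilinear component is spanned by the only variable. -/
theorem exists_permuted_basis_one :
    ∃ b : Module.Basis (Fin 1) K (relMultilinear K (TwoDim π ϱ) 1),
      ∀ σ i, multilinearRep K (TwoDim π ϱ) 1 σ (b i) = b (σ i) := by
  refine exists_permuted_basis (fun i => FreeMagma.of i) (fun i => ?_) ?_ ?_ (fun σ i => rfl)
  · rw [Subsingleton.elim i 0]; rfl
  · intro u hu
    induction u with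
    | ih1 a => exact Or.inr ⟨a, rfl⟩
    | ih2 u w =>
      have hpos : ∀ z : FreeMagma (Fin 1), 0 < Multiset.card (letters z) := by
        intro z
        rw [letters_eq_map_sides true, Multiset.card_map]
        exact (leftCount_pos z).trans_le (Multiset.countP_le_card _ _)
      have hc := congrArg Multiset.card hu
      rw [letters_mul, Multiset.card_add, Finset.card_val, Finset.card_fin] at hc
      have h1 := hpos u
      have h2 := hpos w
      omega
  · rw [linearIndependent_unique_iff]
    intro h
    have := congrArg TwoDim.a (wordClass_eq_zero_iff.1 h fun _ => TwoDim.r π ϱ)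
    simp [TwoDim.r] at this

end TwoDimBasis

/-! ## The characters of the partitions `(n)` and `(n - 1, 1)` -/

theorem mem_oneRow {a : ℕ} {c : ℕ × ℕ} : c ∈ oneRow a ↔ c.1 = 0 ∧ c.2 < a := by
  obtain ⟨i, j⟩ := c
  rw [oneRow, YoungDiagram.mem_ofRowLens]
  rcases i with _ | i <;> simp

theorem mem_twoRows {a b : ℕ} {h : b ≤ a} {c : ℕ × ℕ} :
    c ∈ twoRows a b h ↔ c.1 = 0 ∧ c.2 < a ∨ c.1 = 1 ∧ c.2 < b := by
  obtain ⟨i, j⟩ := c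
  rw [twoRows, YoungDiagram.mem_ofRowLens]
  rcases i with _ | _ | i <;> simp

/-! ### The trivial character -/

section Row

variable (K : Type*) [Field K] (n : ℕ)

theorem spechtPolynomial_oneRow (T : (oneRow n).cells ≃ Fin n) :
    spechtPolynomial K n (oneRow n) T = 1 := by
  rw [spechtPolynomial, Finset.filter_false_of_mem, Finset.prod_empty]
  rintro ⟨p, q⟩ _ ⟨-, h⟩
  have hq := (mem_oneRow.1 ((YoungDiagram.mem_cells _).1 q.2)).1
  exact Nat.not_lt_zero _ (hq ▸ h)

theorem card_cells_oneRow : (oneRow n).cells.card = n := by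
  have h : (oneRow n).cells = (Finset.range n).image fun j => (0, j) := by
    ext ⟨i, j⟩
    rw [YoungDiagram.mem_cells, mem_oneRow]
    simp only [Finset.mem_image, Finset.mem_range, Prod.mk.injEq]
    constructor
    · rintro ⟨rfl, h⟩
      exact ⟨j, h, rfl, rfl⟩
    · rintro ⟨k, h, rfl, rfl⟩
      exact ⟨rfl, h⟩
  rw [h, Finset.card_image_of_injective _ fun a b hab => (Prod.mk.inj hab).2, Finset.card_range]

theorem irrChar_oneRow (σ : Equiv.Perm (Fin n)) : irrChar K n (oneRow n) σ = 1 := by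
  have hspan : spechtModule K n (oneRow n) = Submodule.span K {1} := by
    rw [spechtModule]
    congr 1
    ext f
    constructor
    · rintro ⟨T, rfl⟩
      exact spechtPolynomial_oneRow K n T
    · rintro rfl
      -- A tableau must exist, or the span would be zero.
      exact ⟨Finset.equivFinOfCardEq (card_cells_oneRow n), spechtPolynomial_oneRow K n _⟩
  have hid : spechtRep K n (oneRow n) σ = LinearMap.id := by
    refine LinearMap.ext fun f => Subtype.ext ?_
    obtain ⟨c, hc⟩ := Submodule.mem_span_singleton.1 (hspan ▸ f.2 : f.1 ∈ Submodule.span K {1})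
    change MvPolynomial.rename σ f.1 = f.1
    rw [← hc, map_smul, map_one]
  have : FiniteDimensional K (spechtModule K n (oneRow n)) :=
    FiniteDimensional.span_of_finite K (Set.finite_range _)
  rw [irrChar, Representation.character, hid, LinearMap.trace_id, hspan,
    finrank_span_singleton one_ne_zero, Nat.cast_one]

end Row

/-! ### The shape `(n-1,1)` inside the permutation module -/

section Hook

variable (K : Type*) [Field K] {n : ℕ}

theorem spechtPolynomial_twoRows (h : 1 ≤ n - 1) (T : (twoRows (n - 1) 1 h).cells ≃ Fin n)
    (p q : (twoRows (n - 1) 1 h).cells) (hp : p.1 = (0, 0)) (hq : q.1 = (1, 0)) :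
    spechtPolynomial K n (twoRows (n - 1) 1 h) T =
      MvPolynomial.X (T p) - MvPolynomial.X (T q) := by
  rw [spechtPolynomial, Finset.prod_eq_single (p, q)]
  · rintro ⟨⟨⟨i, j⟩, hc⟩, ⟨⟨i', j'⟩, hc'⟩⟩ hm hne
    exfalso
    apply hne
    have h1 := mem_twoRows.1 ((YoungDiagram.mem_cells _).1 hc)
    have h2 := mem_twoRows.1 ((YoungDiagram.mem_cells _).1 hc')
    have h3 := (Finset.mem_filter.1 hm).2
    simp only at h1 h2 h3
    -- The second row has one cell, so the first column contains the only pair of cells in a common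
    -- column.
    refine Prod.ext (Subtype.ext ?_) (Subtype.ext ?_)
    · rw [hp, Prod.mk.injEq]; omega
    · rw [hq, Prod.mk.injEq]; omega
  · intro hm
    exact absurd (Finset.mem_filter.2 ⟨Finset.mem_univ _, by simp [hp, hq]⟩) hm

theorem card_cells_twoRows (hn : 2 ≤ n) (h : 1 ≤ n - 1) :
    (twoRows (n - 1) 1 h).cells.card = n := by
  have h : (twoRows (n - 1) 1 h).cells =
      insert (1, 0) ((Finset.range (n - 1)).image fun j => (0, j)) := by
    ext ⟨i, j⟩
    rw [YoungDiagram.mem_cells, mem_twoRows]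
    simp only [Finset.mem_insert, Finset.mem_image, Finset.mem_range, Prod.mk.injEq]
    constructor
    · rintro (⟨rfl, h⟩ | ⟨rfl, h⟩)
      · exact Or.inr ⟨j, h, rfl, rfl⟩
      · exact Or.inl ⟨rfl, by omega⟩
    · rintro (⟨rfl, rfl⟩ | ⟨k, h, rfl, rfl⟩)
      · exact Or.inr ⟨rfl, one_pos⟩
      · exact Or.inl ⟨rfl, h⟩
  rw [h, Finset.card_insert_of_notMem (by simp),
    Finset.card_image_of_injective _ fun a b hab => (Prod.mk.inj hab).2, Finset.card_range]
  omega

theorem exists_perm_apply_eq {α : Type*} [DecidableEq α] {a b i j : α} (hab : a ≠ b)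
    (hij : i ≠ j) : ∃ σ : Equiv.Perm α, σ a = i ∧ σ b = j := by
  refine ⟨(Equiv.swap a i).trans (Equiv.swap (Equiv.swap a i b) j), ?_, ?_⟩
  · rw [Equiv.trans_apply, Equiv.swap_apply_left, Equiv.swap_apply_of_ne_of_ne _ hij]
    intro h
    apply hab
    apply (Equiv.swap a i).injective
    rw [← h, Equiv.swap_apply_left]
  · rw [Equiv.trans_apply, Equiv.swap_apply_left]

theorem X_sub_X_mem_spechtModule (hn : 2 ≤ n) (h : 1 ≤ n - 1) (i j : Fin n) :
    (MvPolynomial.X i - MvPolynomial.X j : MvPolynomial (Fin n) K) ∈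
      spechtModule K n (twoRows (n - 1) 1 h) := by
  by_cases hij : i = j
  · rw [hij, sub_self]
    exact zero_mem _
  let p : (twoRows (n - 1) 1 h).cells :=
    ⟨(0, 0), (YoungDiagram.mem_cells _).2 (mem_twoRows.2 (Or.inl ⟨rfl, h⟩))⟩
  let q : (twoRows (n - 1) 1 h).cells :=
    ⟨(1, 0), (YoungDiagram.mem_cells _).2 (mem_twoRows.2 (Or.inr ⟨rfl, one_pos⟩))⟩
  have hpq : p ≠ q := fun h => by simpa [p, q] using congrArg (fun c => c.1.1) h
  let e := Finset.equivFinOfCardEq (card_cells_twoRows hn h)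
  obtain ⟨σ, hp, hq⟩ := exists_perm_apply_eq (e.injective.ne hpq) hij
  refine Submodule.subset_span ⟨e.trans σ, ?_⟩
  rw [spechtPolynomial_twoRows K h _ p q rfl rfl, Equiv.trans_apply, Equiv.trans_apply, hp, hq]

variable (n) in
/-- The coefficients of the linear part of a polynomial. -/
def linearCoeffs : MvPolynomial (Fin n) K →ₗ[K] (Fin n → K) :=
  LinearMap.pi fun i => MvPolynomial.lcoeff K (Finsupp.single i 1)

theorem linearCoeffs_apply (f : MvPolynomial (Fin n) K) (i : Fin n) :
    linearCoeffs K n f i = f.coeff (Finsupp.single i 1) := rfl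

theorem linearCoeffs_X (i : Fin n) :
    linearCoeffs K n (MvPolynomial.X i) = Pi.single i 1 := by
  funext j
  rw [linearCoeffs_apply, MvPolynomial.coeff_X, Pi.single_apply]
  simp [Finsupp.single_left_inj, eq_comm]

theorem linearCoeffs_rename (σ : Equiv.Perm (Fin n)) (f : MvPolynomial (Fin n) K) (i : Fin n) :
    linearCoeffs K n (MvPolynomial.rename σ f) (σ i) = linearCoeffs K n f i := by
  rw [linearCoeffs_apply, linearCoeffs_apply,
    ← MvPolynomial.coeff_rename_mapDomain σ σ.injective f, Finsupp.mapDomain_single]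

/-- The generators are differences of two variables. The second part makes `linearCoeffs` injective
on the Specht module. -/
theorem sum_linearCoeffs_eq_zero {h : 1 ≤ n - 1} {f : MvPolynomial (Fin n) K}
    (hf : f ∈ spechtModule K n (twoRows (n - 1) 1 h)) :
    ∑ i, linearCoeffs K n f i = 0 ∧
      ∑ i, linearCoeffs K n f i • (MvPolynomial.X i : MvPolynomial (Fin n) K) = f := by
  induction hf using Submodule.span_induction with
  | mem f hf =>
    obtain ⟨T, rfl⟩ := hf
    rw [spechtPolynomial_twoRows K h T
      ⟨(0, 0), (YoungDiagram.mem_cells _).2 (mem_twoRows.2 (Or.inl ⟨rfl, h⟩))⟩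
      ⟨(1, 0), (YoungDiagram.mem_cells _).2 (mem_twoRows.2 (Or.inr ⟨rfl, one_pos⟩))⟩ rfl rfl]
    simp [linearCoeffs_X, sub_smul, Pi.single_apply]
  | zero => simp
  | add f g _ _ hf hg =>
    simp only [map_add, Pi.add_apply, Finset.sum_add_distrib, add_smul, hf.1, hg.1, hf.2, hg.2,
      add_zero, and_self]
  | smul c f _ hf =>
    simp only [map_smul, Pi.smul_apply, smul_eq_mul, mul_smul, ← Finset.mul_sum,
      ← Finset.smul_sum, hf.1, hf.2, mul_zero, and_self]

variable (n) in
/-- The sum of the trivial module and the Specht module of shape `(n - 1, 1)` as a subspace of the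
permutation module. -/
def hookSum (h : 1 ≤ n - 1) :
    K × spechtModule K n (twoRows (n - 1) 1 h) →ₗ[K] (Fin n → K) :=
  LinearMap.coprod (LinearMap.pi fun _ => LinearMap.id)
    ((linearCoeffs K n).comp (Submodule.subtype _))

theorem hookSum_apply (h : 1 ≤ n - 1) (c : K) (f : spechtModule K n (twoRows (n - 1) 1 h))
    (i : Fin n) : hookSum K n h (c, f) i = c + linearCoeffs K n f.1 i := by
  simp [hookSum]

theorem hookSum_bijective [CharZero K] (hn : 2 ≤ n) (h : 1 ≤ n - 1) :
    Function.Bijective (hookSum K n h) := by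
  have hn0 : (n : K) ≠ 0 := Nat.cast_ne_zero.2 (by omega)
  constructor
  · rw [injective_iff_map_eq_zero]
    rintro ⟨c, f⟩ hcf
    have hi : ∀ i, c + linearCoeffs K n f.1 i = 0 := fun i => by
      rw [← hookSum_apply, hcf, Pi.zero_apply]
    obtain ⟨h1, h2⟩ := sum_linearCoeffs_eq_zero K f.2
    -- Adding all coordinates gives `n c = 0`; characteristic zero enters here.
    have hsum := Finset.sum_eq_zero fun i (_ : i ∈ Finset.univ) => hi i
    rw [Finset.sum_add_distrib, h1, add_zero, Finset.sum_const, Finset.card_univ,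
      Fintype.card_fin, nsmul_eq_mul] at hsum
    have hc : c = 0 := (mul_eq_zero.1 hsum).resolve_left hn0
    have hf : f.1 = 0 := by
      rw [← h2]
      refine Finset.sum_eq_zero fun i _ => ?_
      have := hi i
      rw [hc, zero_add] at this
      rw [this, zero_smul]
    exact Prod.ext hc (Subtype.ext hf)
  · intro d
    -- The constant part is the mean; what remains has coordinate sum zero and is a combination of
    -- the differences `X i - X o`.
    set c : K := (∑ i, d i) / n with hc
    have hd : ∑ i, (d i - c) = 0 := by
      rw [Finset.sum_sub_distrib, Finset.sum_const, Finset.card_univ, Fintype.card_fin,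
        nsmul_eq_mul, hc, mul_div_cancel₀ _ hn0, sub_self]
    have hmem : ∑ i, (d i - c) • (MvPolynomial.X i : MvPolynomial (Fin n) K) ∈
        spechtModule K n (twoRows (n - 1) 1 h) := by
      let o : Fin n := ⟨0, by omega⟩
      have : ∑ i, (d i - c) • (MvPolynomial.X i : MvPolynomial (Fin n) K) =
          ∑ i, (d i - c) • (MvPolynomial.X i - MvPolynomial.X o) := by
        simp only [smul_sub]
        rw [Finset.sum_sub_distrib, ← Finset.sum_smul, hd, zero_smul, sub_zero]
      rw [this]
      exact Submodule.sum_mem _ fun i _ =>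
        Submodule.smul_mem _ _ (X_sub_X_mem_spechtModule K hn h i o)
    refine ⟨(c, ⟨_, hmem⟩), funext fun i => ?_⟩
    rw [hookSum_apply]
    simp [linearCoeffs_X, Pi.single_apply]

theorem irrChar_twoRows [CharZero K] (hn : 2 ≤ n) (h : 1 ≤ n - 1) (σ : Equiv.Perm (Fin n)) :
    1 + irrChar K n (twoRows (n - 1) 1 h) σ = ∑ i, if σ i = i then 1 else 0 := by
  let E := LinearEquiv.ofBijective _ (hookSum_bijective K hn h)
  let b := (Pi.basisFun K (Fin n)).map E.symm
  have : FiniteDimensional K (spechtModule K n (twoRows (n - 1) 1 h)) :=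
    FiniteDimensional.span_of_finite K (Set.finite_range _)
  -- Equivariance: under `E` the action on the direct sum becomes the permutation of coordinates, so
  -- it permutes the pulled-back standard basis.
  have hE : ∀ z i, E (LinearMap.prodMap LinearMap.id
      (spechtRep K n (twoRows (n - 1) 1 h) σ) z) (σ i) = E z i := by
    rintro ⟨c, f⟩ i
    change hookSum K n h (c, _) (σ i) = hookSum K n h (c, f) i
    rw [hookSum_apply, hookSum_apply, ← linearCoeffs_rename K σ f.1]
    rfl
  rw [← trace_eq_sum_of_permutes b σ (LinearMap.prodMap LinearMap.id
    (spechtRep K n (twoRows (n - 1) 1 h) σ)), LinearMap.trace_prodMap', LinearMap.trace_id,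
    Module.finrank_self, Nat.cast_one]
  · rfl
  · intro i
    apply E.injective
    funext j
    obtain ⟨k, rfl⟩ := σ.surjective j
    rw [hE]
    simp [b, Pi.single_apply]

theorem cocharacter_eq_irrChar_add_irrChar [CharZero K] {A : Type*} [NonUnitalNonAssocRing A]
    [Module K A] [IsScalarTower K A A] [SMulCommClass K A A] (hn : 2 ≤ n) (h : 1 ≤ n - 1)
    (b : Module.Basis (Fin n) K (relMultilinear K A n))
    (hb : ∀ σ i, multilinearRep K A n σ (b i) = b (σ i)) :
    cocharacter K A n = irrChar K n (oneRow n) + irrChar K n (twoRows (n - 1) 1 h) := by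
  rw [cocharacter_eq_of_basis b hb]
  funext σ
  rw [Pi.add_apply, irrChar_oneRow, irrChar_twoRows K hn]

theorem cocharacter_one_eq_irrChar {A : Type*} [NonUnitalNonAssocRing A]
    [Module K A] [IsScalarTower K A A] [SMulCommClass K A A]
    (b : Module.Basis (Fin 1) K (relMultilinear K A 1))
    (hb : ∀ σ i, multilinearRep K A 1 σ (b i) = b (σ i)) :
    cocharacter K A 1 = irrChar K 1 (oneRow 1) := by
  rw [cocharacter_eq_of_basis b hb]
  funext σ
  rw [irrChar_oneRow, Fin.sum_univ_one, if_pos (Subsingleton.elim _ _)]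

end Hook

end BicommVar

end

open BicommVar in
theorem theorem5p2 (K : Type*) [Field K] [CharZero K] :
    -- (i) the varieties generated by `A_{0,1}` and `A_{1,0}`
    ((∀ (B : Type*) [NonUnitalNonAssocRing B] [Module K B] [IsScalarTower K B B]
        [SMulCommClass K B B],
        (InVarietyGeneratedBy K (TwoDim (0 : K) 1) B ↔
          InVariety (bicommutativity K) B ∧ InVariety {leftNilpotency K} B) ∧
        (InVarietyGeneratedBy K (TwoDim (1 : K) 0) B ↔
          InVariety (bicommutativity K) B ∧ InVariety {rightNilpotency K} B)) ∧
      (cocharacter K (TwoDim (0 : K) 1) 1 = irrChar K 1 (oneRow 1) ∧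
        cocharacter K (TwoDim (1 : K) 0) 1 = irrChar K 1 (oneRow 1)) ∧
      (∀ (n : ℕ) (hn : 2 ≤ n),
        cocharacter K (TwoDim (0 : K) 1) n =
          irrChar K n (oneRow n) + irrChar K n (twoRows (n - 1) 1 (by omega)) ∧
        cocharacter K (TwoDim (1 : K) 0) n =
          irrChar K n (oneRow n) + irrChar K n (twoRows (n - 1) 1 (by omega))) ∧
      (∀ n : ℕ, 1 ≤ n →
        codimension K (TwoDim (0 : K) 1) n = n ∧ codimension K (TwoDim (1 : K) 0) n = n)) ∧
    -- (ii) `A_{1,-1}` generates the variety of all bicommutative algebras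
    (∀ (B : Type*) [NonUnitalNonAssocRing B] [Module K B] [IsScalarTower K B B]
        [SMulCommClass K B B],
        InVarietyGeneratedBy K (TwoDim (1 : K) (-1)) B ↔ InVariety (bicommutativity K) B) := by
  refine ⟨⟨fun B _ _ _ _ => ⟨inVarietyGeneratedBy_zero_one, inVarietyGeneratedBy_one_zero⟩,
    ⟨?_, ?_⟩, fun n hn => ⟨?_, ?_⟩, fun n hn => ?_⟩,
    fun B _ _ _ _ => inVarietyGeneratedBy_one_neg_one⟩
  · obtain ⟨b, hb⟩ := exists_permuted_basis_one (K := K) (π := 0) (ϱ := 1)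
    exact cocharacter_one_eq_irrChar K b hb
  · obtain ⟨b, hb⟩ := exists_permuted_basis_one (K := K) (π := 1) (ϱ := 0)
    exact cocharacter_one_eq_irrChar K b hb
  · obtain ⟨b, hb⟩ := exists_permuted_basis_zero_one (K := K) hn
    exact cocharacter_eq_irrChar_add_irrChar K hn _ b hb
  · obtain ⟨b, hb⟩ := exists_permuted_basis_one_zero (K := K) hn
    exact cocharacter_eq_irrChar_add_irrChar K hn _ b hb
  · rcases hn.eq_or_lt with rfl | hn
    · exact ⟨codimension_eq_of_basis exists_permuted_basis_one.choose,
        codimension_eq_of_basis exists_permuted_basis_one.choose⟩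
    · exact ⟨codimension_eq_of_basis (exists_permuted_basis_zero_one hn).choose,
        codimension_eq_of_basis (exists_permuted_basis_one_zero hn).choose⟩
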